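/- Let $I$ be a non-empty finite set with standard basis $(\alpha_i)_{i\in I}$ of $\mathbb{Z}^I$. A generalized Cartan matrix is a matrix $M=(c_{ij})\in\mathbb{Z}^{I\times I}$ with $c_{ii}=2$, with $c_{jk}\le 0$ for $j\neq k$, and such that $c_{ij}=0$ implies $c_{ji}=0$. A Cartan scheme $\mathcal{C}=\mathcal{C}(I,A,(\rho_i)_{i\in I},(C^a)_{a\in A})$ consists of a non-empty set $A$ (of objects), maps $\rho_i:A\to A$ with $\rho_i^2=\mathrm{id}$, and generalized Cartan matrices $C^a=(c^a_{ij})_{i,j\in I}$ with $c^a_{ij}=c^{\rho_i(a)}_{ij}$ for all $a\in A$, $i,j\in I$. Let $\sigma_i^a\in\mathrm{Aut}(\mathbb{Z}^I)$ be given by $\sigma_i^a(\alpha_j)=\alpha_j-c^a_{ij}\alpha_i$, regarded as a morphism from $a$ to $\rho_i(a)$. For $a\in A$ and $i_1,\dots,i_k\in I$ let $\mathrm{id}^a\sigma_{i_1}\cdots\sigma_{i_k}$ denote the composition of these morphisms with target $a$, i.e. $\sigma_{i_1}^{a_1}\sigma_{i_2}^{a_2}\cdots\sigma_{i_k}^{a_k}$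 with $a_1=\rho_{i_1}(a)$ and $a_{l+1}=\rho_{i_{l+1}}(a_l)$. The set of real roots at $a$ is \[ (R^{\mathrm{re}})^a=\{\mathrm{id}^a\sigma_{i_1}\cdots\sigma_{i_k}(\alpha_j)\mid k\ge 0,\ i_1,\dots,i_k,j\in I\}\subseteq\mathbb{Z}^I . \] A family $(R^a)_{a\in A}$ of subsets of $\mathbb{Z}^I$ is a root system of type $\mathcal{C}$ if for all $a\in A$ and $i,j\in I$: (R1) $R^a=R^a_+\cup -R^a_+$, where $R^a_+=R^a\cap\mathbb{N}_0^I$; (R2) $R^a\cap\mathbb{Z}\alpha_i=\{\alpha_i,-\alpha_i\}$; (R3) $\sigma_i^a(R^a)=R^{\rho_i(a)}$; (R4) if $i\ne j$ and $m=|R^a\cap(\mathbb{N}_0\alpha_i+\mathbb{N}_0\alpha_j)|$ is finite, then $(\rho_i\rho_j)^{m}(a)=a$. It is finite if every $R^a$ is finite. The Dynkin diagram at $a$ is the labeled directed graph with vertex set $I$ in which, for $i\neq j$, there is an arrow from $j$ to $i$, labeled $-c^a_{ij}$, if and only if $c^a_{ij}\neq 0$; it is called connected if its underlying undirected graph is connected.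 **Proposition.** Let $\mathcal{C}$ be a Cartan scheme such that the real roots $((R^{\mathrm{re}})^a)_{a\in A}$ form a finite root system of type $\mathcal{C}$, and let $a\in A$. Then the following are equivalent: 1. $\sum_{i\in I}\alpha_i\in (R^{\mathrm{re}})^a$; 2. the Dynkin diagram at $a$ is connected. -/

import Mathlib

/-- A generalized Cartan matrix with index set `I`. -/
structure IsGeneralizedCartanMatrix {I : Type*} (M : Matrix I I ℤ) : Prop where
  diag : ∀ i, M i i = 2
  nonpos : ∀ j k, j ≠ k → M j k ≤ 0
  zero_symm : ∀ i j, M i j = 0 → M j i = 0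

/-- A Cartan scheme with finite non-empty index set `I` and non-empty set of objects `A`.
Here `refl i` is the map `ρ_i : A → A` and `cartan a` is the generalized Cartan matrix `C^a`. -/
structure CartanScheme (I A : Type*) [Fintype I] [Nonempty I] [Nonempty A] where
  refl : I → A → A
  cartan : A → Matrix I I ℤ
  isGCM : ∀ a, IsGeneralizedCartanMatrix (cartan a)
  refl_refl : ∀ i a, refl i (refl i a) = a
  cartan_refl : ∀ a i j, cartan a i j = cartan (refl i a) i j

/-- The standard basis vector `α_i` of `ℤ^I`. -/
def simpleRoot {I : Type*} [DecidableEq I] (i : I) : I → ℤ := Pi.single i 1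

namespace CartanScheme

variable {I A : Type*} [Fintype I] [DecidableEq I] [Nonempty I] [Nonempty A]

/-- The linear form on `ℤ^I` with `α_j ↦ c^a_{ij}` for all `j`. -/
def cartanForm (C : CartanScheme I A) (a : A) (i : I) : (I → ℤ) →ₗ[ℤ] ℤ :=
  LinearMap.proj i ∘ₗ (C.cartan a).mulVecLin

theorem cartanForm_simpleRoot (C : CartanScheme I A) (a : A) (i j : I) :
    C.cartanForm a i (simpleRoot j) = C.cartan a i j := by
  simp [cartanForm, simpleRoot]

/-- The automorphism `σ_i^a` of `ℤ^I`, regarded as a morphism from `a` to `ρ_i(a)`. -/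
def sigma (C : CartanScheme I A) (a : A) (i : I) : (I → ℤ) ≃ₗ[ℤ] (I → ℤ) :=
  Module.reflection (x := simpleRoot i) (f := C.cartanForm a i)
    ((C.cartanForm_simpleRoot a i i).trans ((C.isGCM a).diag i))

/-- The defining formula `σ_i^a(α_j) = α_j - c^a_{ij} α_i`. -/
theorem sigma_simpleRoot (C : CartanScheme I A) (a : A) (i j : I) :
    C.sigma a i (simpleRoot j) = simpleRoot j - C.cartan a i j • simpleRoot i := by
  rw [sigma, Module.reflection_apply, cartanForm_simpleRoot]

/-- The morphism `id^a σ_{i₁} ⋯ σ_{iₖ}` of the Weyl groupoid, with target `a`, for a list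
`[i₁, …, iₖ]`. Its leftmost factor is `σ_{i₁}` from `ρ_{i₁}(a)` to `a`; the remaining
factors form the morphism `id^b σ_{i₂} ⋯ σ_{iₖ}` with `b = ρ_{i₁}(a)`. -/
def wordMap (C : CartanScheme I A) : A → List I → ((I → ℤ) ≃ₗ[ℤ] (I → ℤ))
  | _, [] => LinearEquiv.refl ℤ (I → ℤ)
  | a, i :: l => (C.wordMap (C.refl i a) l).trans (C.sigma (C.refl i a) i)

/-- The set of real roots at `a`. -/
def realRoots (C : CartanScheme I A) (a : A) : Set (I → ℤ) :=
  {v | ∃ (l : List I) (j : I), v = C.wordMap a l (simpleRoot j)}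

/-- The set `R ∩ (ℕ₀ α_i + ℕ₀ α_j)`, whose cardinality is `m_{i,j}` for `R = R^a`. -/
def rankTwoRoots (R : Set (I → ℤ)) (i j : I) : Set (I → ℤ) :=
  R ∩ {v | ∃ m n : ℕ, v = (m : ℤ) • simpleRoot i + (n : ℤ) • simpleRoot j}

/-- The family `(R^a)` of subsets of `ℤ^I` is a root system of type `C`. -/
structure IsRootSystem (C : CartanScheme I A) (R : A → Set (I → ℤ)) : Prop where
  /-- `R^a = R^a_+ ∪ -R^a_+`, where `R^a_+` consists of the elements of `R^a` in `ℕ₀^I`. -/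
  pos_or_neg : ∀ a, R a = {v | v ∈ R a ∧ 0 ≤ v} ∪ {v | -v ∈ R a ∧ 0 ≤ -v}
  /-- `R^a ∩ ℤ α_i = {α_i, -α_i}`. -/
  multiples : ∀ a i,
    R a ∩ {v | ∃ n : ℤ, v = n • simpleRoot i} = {simpleRoot i, -simpleRoot i}
  /-- `σ_i^a(R^a) = R^{ρ_i(a)}`. -/
  image_sigma : ∀ a i, C.sigma a i '' R a = R (C.refl i a)
  /-- `(ρ_i ρ_j)^{m_{i,j}^a}(a) = a` whenever `i ≠ j` and `m_{i,j}^a` is finite. -/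
  coxeter : ∀ a i j, i ≠ j → (rankTwoRoots (R a) i j).Finite →
    (C.refl i ∘ C.refl j)^[(rankTwoRoots (R a) i j).ncard] a = a

/-- The root system is finite, that is, each `R^a` is finite. -/
structure IsFiniteRootSystem (C : CartanScheme I A) (R : A → Set (I → ℤ)) : Prop where
  isRootSystem : C.IsRootSystem R
  finite : ∀ a, (R a).Finite

end CartanScheme

/-- A directed graph together with an integer label for each of its arrows. -/
structure LabeledDigraph (V : Type*) where
  graph : Digraph V
  label : {e : V × V // graph.Adj e.1 e.2} → ℤ

/-- A directed graph is connected if the undirected graph obtained by forgetting the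
directions of the arrows is connected. -/
def LabeledDigraph.Connected {V : Type*} (D : LabeledDigraph V) : Prop :=
  D.graph.toSimpleGraphInclusive.Connected

/-- The Dynkin diagram at `a`: for `i ≠ j` there is an arrow from `j` to `i` if and only if
`c^a_{ij} ≠ 0`, and this arrow is labeled `-c^a_{ij}`. -/
def CartanScheme.dynkinDiagram {I A : Type*} [Fintype I] [Nonempty I] [Nonempty A]
    (C : CartanScheme I A) (a : A) : LabeledDigraph I where
  graph := { Adj := fun j i => i ≠ j ∧ C.cartan a i j ≠ 0 }
  label := fun e => -C.cartan a e.1.2 e.1.1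

/-! If the diagram splits along `S`, all reflections reachable from `a` respect the splitting
(`Separates.refl`). So every real root is supported in `S` or in its complement, and the all-ones
vector is not a root.

Conversely, connected sets are built one vertex at a time. Sums of roots are produced by
contradiction: if a vector `x` has no multiple among the roots, some linear form `f` is non-zero on
all roots but puts the hyperplane of a lexicographically smaller form through `x`. By
`exists_chamber`, `f` is positive on the simple roots of another object, transported to `a`. Roots
with `f`-value 1 are then simple in that chamber, and a root with coordinates of both signs, there
or at `a`, contradicts (R1). This gives `add_mem_realRoots_of_add_smul_mem`, hence the case of an
edge, and `add_add_mem_realRoots`, hence the induction step. -/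

/-! ### Linear forms on finite sets, and lexicographic combinations of them. -/

theorem exists_dual_ne_zero_of_finite {I : Type*} {S : Set (I → ℤ)} (hS : S.Finite) :
    ∃ f : (I → ℤ) →ₗ[ℤ] ℤ, ∀ s ∈ S, f s = 0 → s = 0 := by
  induction S, hS using Set.Finite.induction_on with
  | empty => exact ⟨0, by simp⟩
  | @insert v S _ hS ih =>
    obtain ⟨f, hf⟩ := ih
    by_cases hv : v = 0
    · exact ⟨f, by rintro s (rfl | hs) h; exacts [hv, hf s hs h]⟩
    obtain ⟨i, hi⟩ := Function.ne_iff.1 hv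
    obtain ⟨K, hK⟩ := (hS.image fun s => |s i|).bddAbove
    have hK' : ∀ s ∈ S, |s i| ≤ K := fun s hs => hK ⟨s, hs, rfl⟩
    by_cases hfv : f v = 0
    -- The factor exceeds every `|s i|` on `S`, so the added coordinate cannot cancel a non-zero
    -- value of `f`.
    · refine ⟨(|K| + 1) • f + LinearMap.proj i, ?_⟩
      rintro s (rfl | hs) h
      · simp [hfv] at h
        exact absurd h hi
      · refine hf s hs ?_
        simp at h
        have h1 := (hK' s hs).trans (le_abs_self K)
        rw [abs_le] at h1
        have h2 := abs_nonneg K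
        rcases lt_trichotomy (f s) 0 with h0 | h0 | h0
        · nlinarith
        · exact h0
        · nlinarith
    · exact ⟨f, by rintro s (rfl | hs) h; exacts [absurd h hfv, hf s hs h]⟩

theorem exists_bound_of_finite {I : Type*} {S : Set (I → ℤ)} (hS : S.Finite)
    (f : (I → ℤ) →ₗ[ℤ] ℤ) : ∃ M : ℤ, ∀ K, M ≤ K → ∀ s ∈ S, |f s| < K := by
  obtain ⟨M, hM⟩ := (hS.image fun s => |f s|).bddAbove
  exact ⟨M + 1, fun K hK s hs => by have : |f s| ≤ M := hM ⟨s, hs, rfl⟩; omega⟩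

/-- In a lexicographic form `M * a + c` with `c` small, the leading term decides the sign. -/
theorem nonneg_of_mul_add_nonneg {M a c : ℤ} (hc : |c| < M) (h : 0 ≤ M * a + c) : 0 ≤ a := by
  rw [abs_lt] at hc
  by_contra! ha
  nlinarith

theorem eq_zero_of_mul_add_eq_zero {M a c : ℤ} (hc : |c| < M) (h : M * a + c = 0) :
    a = 0 ∧ c = 0 := by
  have h1 : 0 ≤ a := nonneg_of_mul_add_nonneg hc h.ge
  have h2 : 0 ≤ -a := nonneg_of_mul_add_nonneg (c := -c) (by rwa [abs_neg]) (by linarith)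
  have : a = 0 := by omega
  subst this
  simpa using h

section

variable {I : Type*} [DecidableEq I]

theorem simpleRoot_nonneg (i : I) : (0 : I → ℤ) ≤ simpleRoot i := by
  rw [simpleRoot]
  exact Pi.single_nonneg.2 zero_le_one

theorem simpleRoot_self (i : I) : (simpleRoot i : I → ℤ) i = 1 := by simp [simpleRoot]

theorem simpleRoot_ne {i j : I} (h : j ≠ i) : (simpleRoot i : I → ℤ) j = 0 := by
  simp [simpleRoot, h]

variable [Fintype I]

theorem map_eq_sum_simpleRoot (f : (I → ℤ) →ₗ[ℤ] ℤ) (y : I → ℤ) :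
    f y = ∑ j, y j * f (simpleRoot j) := by
  conv_lhs => rw [pi_eq_sum_univ' y]
  simp only [map_sum, map_smul, smul_eq_mul]
  rfl

theorem eq_zero_of_map_nonpos {f : (I → ℤ) →ₗ[ℤ] ℤ} (hf : ∀ j, 0 < f (simpleRoot j))
    {y : I → ℤ} (hy : 0 ≤ y) (h : f y ≤ 0) : y = 0 := by
  rw [map_eq_sum_simpleRoot] at h
  have h0 : ∀ j ∈ Finset.univ, 0 ≤ y j * f (simpleRoot j) :=
    fun j _ => mul_nonneg (hy j) (hf j).le
  have h1 := (Finset.sum_eq_zero_iff_of_nonneg h0).1 (le_antisymm h (Finset.sum_nonneg h0))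
  ext j
  exact (mul_eq_zero.1 (h1 j (Finset.mem_univ j))).resolve_right (hf j).ne'

theorem eq_simpleRoot_of_map_eq_one {f : (I → ℤ) →ₗ[ℤ] ℤ} (hf : ∀ j, 0 < f (simpleRoot j))
    {y : I → ℤ} (hy : 0 ≤ y) (h : f y = 1) : ∃ p, y = simpleRoot p := by
  obtain ⟨p, hp⟩ : ∃ p, y p ≠ 0 := by
    by_contra! h0
    rw [show y = 0 from funext h0, map_zero] at h
    exact zero_ne_one h
  refine ⟨p, sub_eq_zero.1 (eq_zero_of_map_nonpos hf (fun k => ?_) ?_)⟩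
  · have := hy k
    rcases eq_or_ne k p with rfl | hk
    · simp only [Pi.zero_apply, Pi.sub_apply, simpleRoot_self] at this ⊢; omega
    · simpa [simpleRoot_ne hk] using this
  · have := hf p
    rw [map_sub]; omega

end

/-! ### Reflections, sign properties of roots, and chambers. -/

namespace CartanScheme

variable {I A : Type*} [Fintype I] [DecidableEq I] [Nonempty I] [Nonempty A]

theorem sigma_apply (C : CartanScheme I A) (a : A) (i : I) (x : I → ℤ) :
    C.sigma a i x = x - C.cartanForm a i x • simpleRoot i := by
  rw [sigma, Module.reflection_apply]

theorem sigma_apply_of_ne (C : CartanScheme I A) (a : A) {i j : I} (h : j ≠ i) (x : I → ℤ) :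
    C.sigma a i x j = x j := by
  simp [sigma_apply, simpleRoot_ne h]

theorem sigma_simpleRoot_self (C : CartanScheme I A) (a : A) (i : I) :
    C.sigma a i (simpleRoot i) = -simpleRoot i := by
  rw [sigma_simpleRoot, (C.isGCM a).diag, two_smul]; abel

theorem simpleRoot_mem_realRoots (C : CartanScheme I A) (a : A) (i : I) :
    simpleRoot i ∈ C.realRoots a := ⟨[], i, rfl⟩

/-- A real root is the image of a basis vector under an automorphism of the lattice, hence
primitive. -/
theorem eq_one_or_of_smul_mem_realRoots (C : CartanScheme I A) {a : A} {n : ℤ} {x : I → ℤ}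
    (h : n • x ∈ C.realRoots a) : n = 1 ∨ n = -1 := by
  obtain ⟨l, j, h⟩ := h
  have h1 := congrArg (fun y => (C.wordMap a l).symm y j) h
  simp only [map_smul, LinearEquiv.symm_apply_apply, Pi.smul_apply, smul_eq_mul,
    simpleRoot_self] at h1
  exact Int.isUnit_iff.1 (IsUnit.of_mul_eq_one _ h1)

namespace IsRootSystem

variable {C : CartanScheme I A} {R : A → Set (I → ℤ)}

theorem neg_mem (h : C.IsRootSystem R) {a : A} {x : I → ℤ} (hx : x ∈ R a) : -x ∈ R a := by
  have h1 := hx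
  rw [h.pos_or_neg a] at h1
  rcases h1 with h1 | h1
  · rw [h.pos_or_neg a]
    right
    simpa using h1
  · exact h1.1

theorem nonneg_or_neg_nonneg (h : C.IsRootSystem R) {a : A} {x : I → ℤ} (hx : x ∈ R a) :
    0 ≤ x ∨ 0 ≤ -x := by
  rw [h.pos_or_neg a] at hx
  exact hx.imp And.right And.right

theorem nonneg_of_pos (h : C.IsRootSystem R) {a : A} {x : I → ℤ} (hx : x ∈ R a) {j : I}
    (hj : 0 < x j) : 0 ≤ x :=
  (h.nonneg_or_neg_nonneg hx).resolve_right fun h1 => by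
    have := h1 j
    simp at this
    omega

theorem not_pos_and_neg (h : C.IsRootSystem R) {a : A} {x : I → ℤ} (hx : x ∈ R a) {i j : I}
    (hi : 0 < x i) (hj : x j < 0) : False :=
  absurd (h.nonneg_of_pos hx hi j) (by simpa using hj)

theorem sigma_mem (h : C.IsRootSystem R) {a : A} (i : I) {x : I → ℤ} (hx : x ∈ R a) :
    C.sigma a i x ∈ R (C.refl i a) := by
  rw [← h.image_sigma]; exact ⟨x, hx, rfl⟩

theorem sigma_refl_mem_iff (h : C.IsRootSystem R) (a : A) (i : I) (x : I → ℤ) :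
    C.sigma (C.refl i a) i x ∈ R a ↔ x ∈ R (C.refl i a) := by
  have := h.image_sigma (C.refl i a) i
  rw [C.refl_refl] at this
  rw [← this]
  exact (C.sigma (C.refl i a) i).injective.mem_set_image

/-- Reflecting in a simple root with negative `f`-value lowers the number of positive roots on which
`f` is negative: the reflection permutes the other positive roots and removes that simple root from
the count. -/
theorem exists_chamber (h : C.IsRootSystem R) (hs : ∀ a i, simpleRoot i ∈ R a)
    (hfin : ∀ a, (R a).Finite) (a : A) (f : (I → ℤ) →ₗ[ℤ] ℤ) (hf : ∀ x ∈ R a, f x ≠ 0) :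
    ∃ (b : A) (w : (I → ℤ) ≃ₗ[ℤ] (I → ℤ)), (∀ x, w x ∈ R a ↔ x ∈ R b) ∧
      ∀ j, 0 < f (w (simpleRoot j)) := by
  induction hn : {x | x ∈ R a ∧ 0 ≤ x ∧ f x < 0}.ncard using Nat.strong_induction_on
    generalizing a f with
  | _ n ih =>
  subst hn
  by_cases hpos : ∀ j, 0 < f (simpleRoot j)
  · exact ⟨a, LinearEquiv.refl ℤ _, fun x => Iff.rfl, hpos⟩
  push Not at hpos
  obtain ⟨i, hi⟩ := hpos
  replace hi : f (simpleRoot i) < 0 := lt_of_le_of_ne hi (hf _ (hs a i))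
  set s := C.sigma (C.refl i a) i with hsdef
  have hmem : ∀ x, s x ∈ R a ↔ x ∈ R (C.refl i a) := h.sigma_refl_mem_iff a i
  suffices hlt : {x | x ∈ R (C.refl i a) ∧ 0 ≤ x ∧ f (s x) < 0}.ncard <
      {x | x ∈ R a ∧ 0 ≤ x ∧ f x < 0}.ncard by
    obtain ⟨b, w, hw, hwpos⟩ := ih _ hlt (C.refl i a) (f ∘ₗ s.toLinearMap)
      (fun x hx => hf _ ((hmem x).2 hx)) rfl
    exact ⟨b, w.trans s, fun x => (hmem _).trans (hw x), hwpos⟩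
  have hsub : s '' {x | x ∈ R (C.refl i a) ∧ 0 ≤ x ∧ f (s x) < 0} ⊆
      {x | x ∈ R a ∧ 0 ≤ x ∧ f x < 0} \ {simpleRoot i} := by
    rintro _ ⟨x, ⟨hx, hx0, hfx⟩, rfl⟩
    have hsx := (hmem x).2 hx
    -- A non-negative multiple of `simpleRoot i` is sent to a vector with non-negative `f`-value.
    -- Hence some other coordinate is positive, and the reflection leaves it unchanged.
    obtain ⟨j, hji, hj⟩ : ∃ j, j ≠ i ∧ x j ≠ 0 := by
      by_contra! h0
      have hxi : x = x i • simpleRoot i := by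
        ext j
        rcases eq_or_ne j i with rfl | hj
        · simp [simpleRoot_self]
        · simp [simpleRoot_ne hj, h0 j hj]
      have h1 : f (s x) = -(x i * f (simpleRoot i)) := by
        conv_lhs => rw [hxi, map_smul, hsdef, sigma_simpleRoot_self, map_smul, map_neg,
          smul_eq_mul, mul_neg]
      have h2 := hx0 i
      rw [Pi.zero_apply] at h2
      nlinarith
    have hj0 : 0 < s x j := by
      rw [hsdef, sigma_apply_of_ne C _ hji]
      exact lt_of_le_of_ne (hx0 j) hj.symm
    refine ⟨⟨hsx, h.nonneg_of_pos hsx hj0, hfx⟩, fun he => ?_⟩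
    rw [Set.mem_singleton_iff] at he
    rw [he, simpleRoot_ne hji] at hj0
    exact hj0.false
  have hfinN : {x | x ∈ R a ∧ 0 ≤ x ∧ f x < 0}.Finite := (hfin a).subset fun x hx => hx.1
  calc _ = (s '' {x | x ∈ R (C.refl i a) ∧ 0 ≤ x ∧ f (s x) < 0}).ncard :=
        (Set.ncard_image_of_injective _ s.injective).symm
    _ ≤ ({x | x ∈ R a ∧ 0 ≤ x ∧ f x < 0} \ {simpleRoot i}).ncard :=
        Set.ncard_le_ncard hsub hfinN.sdiff
    _ < _ := Set.ncard_sdiff_singleton_lt_of_mem ⟨hs a i, simpleRoot_nonneg i, hi⟩ hfinN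

theorem chamber_symm_nonneg (h : C.IsRootSystem R) {a b : A} {f : (I → ℤ) →ₗ[ℤ] ℤ}
    {w : (I → ℤ) ≃ₗ[ℤ] (I → ℤ)} (hw : ∀ x, w x ∈ R a ↔ x ∈ R b)
    (hf : ∀ j, 0 < f (w (simpleRoot j))) {x : I → ℤ} (hx : x ∈ R a) (hfx : 0 < f x) :
    0 ≤ w.symm x := by
  have hy : w.symm x ∈ R b := (hw _).1 (by simpa using hx)
  refine (h.nonneg_or_neg_nonneg hy).resolve_right fun h1 => ?_
  have h2 := eq_zero_of_map_nonpos (f := f ∘ₗ w.toLinearMap) hf h1 (by simpa using hfx.le)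
  have h3 : x = 0 := by simpa using h2
  simp [h3] at hfx

theorem exists_eq_chamber_simpleRoot (h : C.IsRootSystem R) {a b : A} {f : (I → ℤ) →ₗ[ℤ] ℤ}
    {w : (I → ℤ) ≃ₗ[ℤ] (I → ℤ)} (hw : ∀ x, w x ∈ R a ↔ x ∈ R b)
    (hf : ∀ j, 0 < f (w (simpleRoot j))) {x : I → ℤ} (hx : x ∈ R a) (hfx : f x = 1) :
    ∃ p, x = w (simpleRoot p) := by
  obtain ⟨p, hp⟩ := eq_simpleRoot_of_map_eq_one (f := f ∘ₗ w.toLinearMap) hf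
    (h.chamber_symm_nonneg hw hf hx (by omega)) (by simpa using hfx)
  exact ⟨p, by rw [← hp, w.apply_symm_apply]⟩

end IsRootSystem

/-! ### Sums of real roots. -/

/-- If `u`, `t` and `u + k t` with `k > 0` are real roots, then so is `u + t`. -/
theorem add_mem_realRoots_of_add_smul_mem {C : CartanScheme I A}
    (hC : C.IsFiniteRootSystem C.realRoots) {a : A} {u t : I → ℤ} {s₁ s₂ : I}
    (hu₁ : u s₁ = 1) (hu₂ : u s₂ = 0) (ht₁ : t s₁ = 0) (ht₂ : t s₂ = 1)
    (hu : u ∈ C.realRoots a) (ht : t ∈ C.realRoots a) {k : ℤ} (hk : 0 < k)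
    (hut : u + k • t ∈ C.realRoots a) : u + t ∈ C.realRoots a := by
  have hR := hC.isRootSystem
  by_contra hne
  let c (s : I) : (I → ℤ) →ₗ[ℤ] ℤ := LinearMap.proj s
  -- The coordinates `s₁`, `s₂` are dual to `u`, `t`, so `q` is a projection with kernel spanned by
  -- `u` and `t`.
  let q : (I → ℤ) →ₗ[ℤ] (I → ℤ) :=
    LinearMap.id - (c s₁).smulRight u - (c s₂).smulRight t
  have hq : ∀ x, q x = x - x s₁ • u - x s₂ • t := fun x => rfl
  obtain ⟨g, hg⟩ := exists_dual_ne_zero_of_finite ((hC.finite a).image q)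
  let d : (I → ℤ) →ₗ[ℤ] ℤ := c s₁ - c s₂
  have hd : ∀ x, d x = x s₁ - x s₂ := fun x => rfl
  obtain ⟨M, hM⟩ := exists_bound_of_finite (hC.finite a) d
  -- A root killed by `f` is a multiple of `u + t`, hence `±(u + t)`, which is excluded. Both `u`
  -- and `-t` have value 1, so they are simple in the chamber, where `u + k • t` has mixed signs.
  let f : (I → ℤ) →ₗ[ℤ] ℤ := M • (g ∘ₗ q) + d
  have hf : ∀ x, f x = M * g (q x) + d x := fun x => rfl
  have hqu : q u = 0 := by simp [hq, hu₁, hu₂]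
  have hqt : q t = 0 := by simp [hq, ht₁, ht₂]
  have hfR : ∀ x ∈ C.realRoots a, f x ≠ 0 := by
    intro x hx h0
    obtain ⟨h1, h2⟩ := eq_zero_of_mul_add_eq_zero (hM M le_rfl x hx) h0
    have h3 : q x = 0 := hg _ ⟨x, hx, rfl⟩ h1
    rw [hq, sub_sub, sub_eq_zero] at h3
    rw [hd, sub_eq_zero] at h2
    rw [← h2, ← smul_add] at h3
    have hx' := hx
    rw [h3] at hx'
    rcases C.eq_one_or_of_smul_mem_realRoots hx' with h4 | h4
    · rw [h4, one_smul] at h3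
      exact hne (h3 ▸ hx)
    · rw [h4, neg_one_smul] at h3
      exact hne (by simpa [h3] using hR.neg_mem hx)
  obtain ⟨b, w, hw, hwf⟩ := hR.exists_chamber C.simpleRoot_mem_realRoots hC.finite a f hfR
  obtain ⟨p, hp⟩ := hR.exists_eq_chamber_simpleRoot hw hwf hu
    (by simp [hf, hd, hqu, hu₁, hu₂])
  obtain ⟨r, hr⟩ := hR.exists_eq_chamber_simpleRoot hw hwf (hR.neg_mem ht)
    (by simp [hf, hd, hqt, ht₁, ht₂])
  have hpr : p ≠ r := by
    rintro rfl
    have := congrFun (hp.trans hr.symm) s₁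
    simp [hu₁, ht₁] at this
  have h1 : u + k • t = w (simpleRoot p - k • simpleRoot r) := by
    rw [map_sub, map_smul, ← hp, ← hr]; simp
  rw [h1, hw] at hut
  refine hR.not_pos_and_neg hut (i := p) (j := r) ?_ ?_
  · simp [simpleRoot_self, simpleRoot_ne hpr]
  · simpa [simpleRoot_self, simpleRoot_ne hpr.symm] using hk

/-- If `u`, `t`, `u + v` and `v + t` are real roots, then so is `u + v + t`. -/
theorem add_add_mem_realRoots {C : CartanScheme I A}
    (hC : C.IsFiniteRootSystem C.realRoots) {a : A} {u v t : I → ℤ} {s₁ s₂ s₃ : I}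
    (hu₁ : u s₁ = 1) (hu₂ : u s₂ = 0) (hu₃ : u s₃ = 0)
    (hv₁ : v s₁ = 0) (hv₂ : v s₂ = 1) (hv₃ : v s₃ = 0)
    (ht₁ : t s₁ = 0) (ht₂ : t s₂ = 0) (ht₃ : t s₃ = 1)
    (hu : u ∈ C.realRoots a) (ht : t ∈ C.realRoots a)
    (huv : u + v ∈ C.realRoots a) (hvt : v + t ∈ C.realRoots a) :
    u + v + t ∈ C.realRoots a := by
  have hR := hC.isRootSystem
  by_contra hne
  let c (s : I) : (I → ℤ) →ₗ[ℤ] ℤ := LinearMap.proj s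
  let q : (I → ℤ) →ₗ[ℤ] (I → ℤ) :=
    LinearMap.id - (c s₁).smulRight u - (c s₂).smulRight v -
      (c s₃).smulRight t
  have hq : ∀ x, q x = x - x s₁ • u - x s₂ • v - x s₃ • t := fun x => rfl
  obtain ⟨g, hg⟩ := exists_dual_ne_zero_of_finite ((hC.finite a).image q)
  let d : (I → ℤ) →ₗ[ℤ] ℤ := c s₂ - c s₁
  have hd : ∀ x, d x = x s₂ - x s₁ := fun x => rfl
  let e : (I → ℤ) →ₗ[ℤ] ℤ := c s₁ - c s₃
  have he : ∀ x, e x = x s₁ - x s₃ := fun x => rfl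
  obtain ⟨M₁, hM₁⟩ := exists_bound_of_finite (hC.finite a) d
  obtain ⟨M₂, hM₂⟩ := exists_bound_of_finite (hC.finite a) e
  obtain ⟨M, h1M, h2M, hM⟩ : ∃ M : ℤ, M₁ ≤ M ∧ M₂ ≤ M ∧ 2 ≤ M :=
    ⟨max M₁ (max M₂ 2), by simp, by simp, by simp⟩
  replace hM₁ := hM₁ M h1M
  replace hM₂ := hM₂ M h2M
  -- Lexicographic in `g ∘ q`, `d`, `e`, whose common zeros among roots are multiples of `u + v +
  -- t`. Both `u + v` and `-t` have value 1; `-u` and `v + t` have value `M - 1`, positive because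
  -- `2 ≤ M`.
  let f : (I → ℤ) →ₗ[ℤ] ℤ := M • (M • (g ∘ₗ q) + d) + e
  have hf : ∀ x, f x = M * (M * g (q x) + d x) + e x := fun x => rfl
  have hqu : q u = 0 := by simp [hq, hu₁, hu₂, hu₃]
  have hqv : q v = 0 := by simp [hq, hv₁, hv₂, hv₃]
  have hqt : q t = 0 := by simp [hq, ht₁, ht₂, ht₃]
  have hfR : ∀ x ∈ C.realRoots a, f x ≠ 0 := by
    intro x hx h0
    obtain ⟨h0', h1⟩ := eq_zero_of_mul_add_eq_zero (hM₂ x hx) h0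
    obtain ⟨h2, h3⟩ := eq_zero_of_mul_add_eq_zero (hM₁ x hx) h0'
    have h4 : q x = 0 := hg _ ⟨x, hx, rfl⟩ h2
    rw [he, sub_eq_zero] at h1
    rw [hd, sub_eq_zero] at h3
    have h5 : x = x s₁ • (u + v + t) := by
      rw [hq, h3, ← h1] at h4
      rw [← sub_eq_zero, ← h4, smul_add, smul_add]
      abel
    have hx' := hx
    rw [h5] at hx'
    rcases C.eq_one_or_of_smul_mem_realRoots hx' with h6 | h6
    · rw [h6, one_smul] at h5
      exact hne (h5 ▸ hx)
    · rw [h6, neg_one_smul] at h5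
      have := hR.neg_mem hx
      rw [h5, neg_neg] at this
      exact hne this
  obtain ⟨b, w, hw, hwf⟩ := hR.exists_chamber C.simpleRoot_mem_realRoots hC.finite a f hfR
  obtain ⟨p, hp⟩ := hR.exists_eq_chamber_simpleRoot hw hwf huv
    (by simp [hf, hd, he, hqu, hqv, hu₁, hu₂, hu₃, hv₁, hv₂, hv₃])
  obtain ⟨r, hr⟩ := hR.exists_eq_chamber_simpleRoot hw hwf (hR.neg_mem ht)
    (by simp [hf, hd, he, hqt, ht₁, ht₂, ht₃])
  have hpr : p ≠ r := by
    rintro rfl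
    have := congrFun (hp.trans hr.symm) s₁
    simp [hu₁, hv₁, ht₁] at this
  have hroot : ∀ j, w (simpleRoot j) ∈ C.realRoots a :=
    fun j => (hw _).2 (C.simpleRoot_mem_realRoots b j)
  -- The coordinates of `t - u` with respect to the chamber are non-negative.
  set y : I → ℤ := w.symm (t - u) with hy
  have hwy : w y = t - u := by simp [hy]
  have hy₁ : y + simpleRoot r = w.symm (-u) := by
    rw [LinearEquiv.eq_symm_apply, map_add, hwy, ← hr]; abel
  have hy₂ : y + simpleRoot p = w.symm (v + t) := by
    rw [LinearEquiv.eq_symm_apply, map_add, hwy, ← hp]; abel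
  have hy₁' : 0 ≤ y + simpleRoot r := by
    rw [hy₁]
    refine hR.chamber_symm_nonneg hw hwf (hR.neg_mem hu) ?_
    simp [hf, hd, he, hqu, hu₁, hu₂, hu₃]
    omega
  have hy₂' : 0 ≤ y + simpleRoot p := by
    rw [hy₂]
    refine hR.chamber_symm_nonneg hw hwf hvt ?_
    simp [hf, hd, he, hqv, hqt, hv₁, hv₂, hv₃, ht₁, ht₂, ht₃]
    omega
  have hy0 : 0 ≤ y := by
    intro j
    rcases eq_or_ne j r with rfl | hj
    · simpa [simpleRoot_ne hpr.symm] using hy₂' j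
    · simpa [simpleRoot_ne hj] using hy₁' j
  -- `g ∘ q` is non-negative on the chamber, `d` on its face where `g ∘ q` vanishes.
  have hgd : ∀ j, 0 ≤ M * g (q (w (simpleRoot j))) + d (w (simpleRoot j)) := fun j =>
    nonneg_of_mul_add_nonneg (hM₂ _ (hroot j)) (hwf j).le
  have hg0 : ∀ j, 0 ≤ g (q (w (simpleRoot j))) := fun j =>
    nonneg_of_mul_add_nonneg (hM₁ _ (hroot j)) (hgd j)
  have hgy : ∀ j, y j * g (q (w (simpleRoot j))) = 0 := by
    have h1 := map_eq_sum_simpleRoot (g ∘ₗ q ∘ₗ w.toLinearMap) y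
    simp only [LinearMap.comp_apply, LinearEquiv.coe_coe, hwy, map_sub, hqt, hqu, sub_zero,
      map_zero] at h1
    have h2 := (Finset.sum_eq_zero_iff_of_nonneg
      (fun j _ => mul_nonneg (hy0 j) (hg0 j))).1 h1.symm
    exact fun j => h2 j (Finset.mem_univ j)
  have hd0 : ∀ j, y j ≠ 0 → 0 ≤ d (w (simpleRoot j)) := fun j hj => by
    have h1 := hgd j
    rwa [(mul_eq_zero.1 (hgy j)).resolve_left hj, mul_zero, zero_add] at h1
  have hdy : ∑ j, y j * d (w (simpleRoot j)) = 1 := by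
    have h1 := map_eq_sum_simpleRoot (d ∘ₗ w.toLinearMap) y
    simp only [LinearMap.comp_apply, LinearEquiv.coe_coe, hwy] at h1
    rw [← h1, hd]
    simp [hu₁, hu₂, ht₁, ht₂]
  -- As the non-negative integers `y j * d (w (simpleRoot j))` sum to 1, a single `j₀` carries the
  -- whole value of `d`.
  obtain ⟨j₀, hj₀⟩ : ∃ j, y j * d (w (simpleRoot j)) ≠ 0 := by
    by_contra! h0
    simp [h0] at hdy
  have hyj₀ : 0 < y j₀ := lt_of_le_of_ne (hy0 j₀) (left_ne_zero_of_mul hj₀).symm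
  have hdj₀ : 0 < d (w (simpleRoot j₀)) :=
    lt_of_le_of_ne (hd0 j₀ hyj₀.ne') (right_ne_zero_of_mul hj₀).symm
  set z : I → ℤ := y - simpleRoot j₀ with hz
  have hz0 : 0 ≤ z := by
    intro j
    rcases eq_or_ne j j₀ with rfl | hj
    · simp [hz, simpleRoot_self]; omega
    · simpa [hz, simpleRoot_ne hj] using hy0 j
  have hzy : ∀ j, z j ≠ 0 → y j ≠ 0 := by
    intro j hj
    rcases eq_or_ne j j₀ with rfl | hj'
    · exact hyj₀.ne'
    · simpa [hz, simpleRoot_ne hj'] using hj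
  have hdz0 : ∀ j ∈ Finset.univ, 0 ≤ z j * d (w (simpleRoot j)) := fun j _ => by
    rcases eq_or_ne (z j) 0 with h0 | h0
    · simp [h0]
    · exact mul_nonneg (hz0 j) (hd0 j (hzy j h0))
  have hdz : ∀ j, z j * d (w (simpleRoot j)) = 0 := by
    have h1 := map_eq_sum_simpleRoot (d ∘ₗ w.toLinearMap) z
    have h2 := map_eq_sum_simpleRoot (d ∘ₗ w.toLinearMap) y
    simp only [LinearMap.comp_apply, LinearEquiv.coe_coe] at h1 h2
    rw [hdy] at h2
    have h3 : d (w z) = 1 - d (w (simpleRoot j₀)) := by rw [hz, map_sub, map_sub, h2]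
    have h4 := Finset.sum_nonneg hdz0
    have h5 := (Finset.sum_eq_zero_iff_of_nonneg hdz0).1 (by omega)
    exact fun j => h5 j (Finset.mem_univ j)
  -- Where `g ∘ q` and `d` both vanish, a root lies in the span of `u + v` and `t`, that is, of the
  -- simple roots `p` and `r` of the chamber.
  have hzpr : ∀ j, j ≠ p → j ≠ r → z j = 0 := by
    intro j hjp hjr
    by_contra h0
    have h1 : q (w (simpleRoot j)) = 0 := hg _ ⟨_, hroot j, rfl⟩
      ((mul_eq_zero.1 (hgy j)).resolve_left (hzy j h0))
    have h2 := (mul_eq_zero.1 (hdz j)).resolve_left h0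
    set x := w (simpleRoot j) with hx
    have h3 : x = w (x s₁ • simpleRoot p - x s₃ • simpleRoot r) := by
      rw [map_sub, map_smul, map_smul, ← hp, ← hr]
      rw [hd, sub_eq_zero] at h2
      rw [hq, h2] at h1
      rw [← sub_eq_zero, ← h1, smul_add, smul_neg]
      abel
    have h4 := congrFun (w.injective (hx.symm.trans h3)) j
    simp [simpleRoot_self, simpleRoot_ne hjp, simpleRoot_ne hjr] at h4
  have hzeq : z = z p • simpleRoot p + z r • simpleRoot r := by
    ext j
    rcases eq_or_ne j p with rfl | hjp
    · simp [simpleRoot_self, simpleRoot_ne hpr]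
    rcases eq_or_ne j r with rfl | hjr
    · simp [simpleRoot_self, simpleRoot_ne hjp]
    · simp [simpleRoot_ne hjp, simpleRoot_ne hjr, hzpr j hjp hjr]
  have hx : w (simpleRoot j₀) = t - u - z p • (u + v) + z r • t := by
    have h1 : simpleRoot j₀ = y - z := by simp [hz]
    rw [h1, map_sub, hwy]
    conv_lhs => rw [hzeq, map_add, map_smul, map_smul, ← hp, ← hr]
    rw [smul_neg]
    abel
  have hzp : (0 : ℤ) ≤ z p := hz0 p
  have hzr : (0 : ℤ) ≤ z r := hz0 r
  -- The coordinates are `1 + z r` at `s₃` and `-1 - z p` at `s₁`.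
  refine hR.not_pos_and_neg (hroot j₀) (i := s₃) (j := s₁) ?_ ?_
  · rw [hx]; simp [hu₃, hv₃, ht₃]; omega
  · rw [hx]; simp [hu₁, hv₁, ht₁]; omega

end CartanScheme

/-! ### Building a connected graph vertex by vertex. -/

/-- The finite sets that are built from a single vertex by successively adding a vertex which is
related to a vertex of the set. -/
inductive Finset.ConnectedBy {I : Type*} [DecidableEq I] (r : I → I → Prop) : Finset I → Prop
  | singleton (i : I) : ConnectedBy r {i}
  | insert {i j : I} {J : Finset I} (hi : i ∉ J) (hj : j ∈ J) (h : r i j)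
      (hJ : ConnectedBy r J) : ConnectedBy r (insert i J)

theorem Finset.ConnectedBy.nonempty {I : Type*} [DecidableEq I] {r : I → I → Prop} {J : Finset I}
    (h : J.ConnectedBy r) : J.Nonempty := by
  cases h <;> simp

theorem SimpleGraph.Connected.connectedBy_univ {I : Type*} [Fintype I] [DecidableEq I]
    {G : SimpleGraph I} (hG : G.Connected) : (Finset.univ : Finset I).ConnectedBy G.Adj := by
  obtain ⟨i₀⟩ := hG.nonempty
  obtain ⟨J, hJ, hmax⟩ := Set.Finite.exists_le_maximal (Set.toFinite {J : Finset I | J.ConnectedBy G.Adj})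
    (Finset.ConnectedBy.singleton (r := G.Adj) i₀)
  suffices h : ∀ j, j ∈ J by
    rw [← Finset.eq_univ_iff_forall.2 h]
    exact hmax.prop
  intro j
  obtain ⟨p⟩ := hG.preconnected i₀ j
  by_contra hj
  -- A walk leaving a maximal such set crosses its boundary along an edge, whose outer end could be
  -- added.
  obtain ⟨d, -, hd1, hd2⟩ := p.exists_boundary_dart (J : Set I) (hJ (by simp)) hj
  exact hd2 (hmax.le_of_ge (.insert hd2 hd1 d.adj.symm hmax.prop) (Finset.subset_insert _ _)
    (Finset.mem_insert_self _ _))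

theorem sum_simpleRoot_apply_of_mem {I : Type*} [DecidableEq I] {J : Finset I} {k : I} (h : k ∈ J) :
    (∑ i ∈ J, simpleRoot i : I → ℤ) k = 1 := by
  simp [simpleRoot, Finset.sum_apply, Pi.single_apply, h]

theorem sum_simpleRoot_apply_of_notMem {I : Type*} [DecidableEq I] {J : Finset I} {k : I} (h : k ∉ J) :
    (∑ i ∈ J, simpleRoot i : I → ℤ) k = 0 := by
  simp [simpleRoot, Finset.sum_apply, Pi.single_apply, h]

/-! ### Roots of connected sets, and splittings of the Cartan matrix. -/

namespace CartanScheme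

variable {I A : Type*} [Fintype I] [Nonempty I] [Nonempty A]

/-- The Cartan matrix at `a` has only zero entries at `S × Sᶜ` and `Sᶜ × S`. -/
def Separates (C : CartanScheme I A) (a : A) (S : Set I) : Prop :=
  ∀ i ∈ S, ∀ j ∉ S, C.cartan a i j = 0 ∧ C.cartan a j i = 0

theorem Separates.compl {C : CartanScheme I A} {a : A} {S : Set I} (h : C.Separates a S) :
    C.Separates a Sᶜ :=
  fun i hi j hj => (h j (not_not.1 hj) i hi).symm

theorem cartanForm_apply (C : CartanScheme I A) (a : A) (i : I) (x : I → ℤ) :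
    C.cartanForm a i x = ∑ j, C.cartan a i j * x j := by
  simp [cartanForm, Matrix.mulVec, dotProduct]

theorem dynkinDiagram_adj (C : CartanScheme I A) (a : A) (i j : I) :
    (C.dynkinDiagram a).graph.toSimpleGraphInclusive.Adj i j ↔ i ≠ j ∧ C.cartan a i j ≠ 0 := by
  rw [Digraph.toSimpleGraphInclusive, SimpleGraph.fromRel_adj]
  refine and_congr_right fun hij => ⟨?_, fun h => Or.inr ⟨hij, h⟩⟩
  rintro (h | h)
  · exact fun h0 => h.2 ((C.isGCM a).zero_symm _ _ h0)
  · exact h.2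

variable [DecidableEq I]

/-- The reflected simple root `simpleRoot j - c • simpleRoot i`, with `c < 0` the Cartan entry, is
the far end of the string from `simpleRoot j`. -/
theorem simpleRoot_add_simpleRoot_mem_realRoots {C : CartanScheme I A}
    (hC : C.IsFiniteRootSystem C.realRoots) {a : A} {i j : I} (hij : i ≠ j)
    (h : C.cartan a i j ≠ 0) : simpleRoot i + simpleRoot j ∈ C.realRoots a := by
  rw [add_comm]
  have h1 : C.cartan a i j < 0 := lt_of_le_of_ne ((C.isGCM a).nonpos i j hij) h
  refine add_mem_realRoots_of_add_smul_mem hC (s₁ := j) (s₂ := i) (simpleRoot_self j)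
    (simpleRoot_ne hij) (simpleRoot_ne hij.symm) (simpleRoot_self i)
    (C.simpleRoot_mem_realRoots a j) (C.simpleRoot_mem_realRoots a i)
    (k := -C.cartan a i j) (by omega) ?_
  rw [neg_smul, ← sub_eq_add_neg, C.cartan_refl, ← sigma_simpleRoot,
    hC.isRootSystem.sigma_refl_mem_iff]
  exact C.simpleRoot_mem_realRoots _ j

theorem sum_simpleRoot_mem_realRoots {C : CartanScheme I A}
    (hC : C.IsFiniteRootSystem C.realRoots) {a : A} {r : I → I → Prop}
    (hne : ∀ i j, r i j → i ≠ j) (hr : ∀ i j, r i j → C.cartan a i j ≠ 0)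
    {J : Finset I} (hJ : J.ConnectedBy r) :
    ∑ i ∈ J, simpleRoot i ∈ C.realRoots a := by
  induction hn : J.card using Nat.strong_induction_on generalizing J with
  | _ n ih =>
  subst hn
  rcases hJ with i | ⟨hi, hj, hij, hK⟩
  · simpa using C.simpleRoot_mem_realRoots a i
  rename_i i j K
  rcases hK with l | ⟨hl, hl', hll', hK'⟩
  · obtain rfl : j = l := by simpa using hj
    rw [Finset.sum_insert hi, Finset.sum_singleton]
    exact simpleRoot_add_simpleRoot_mem_realRoots hC (hne _ _ hij) (hr _ _ hij)
  rename_i l l' K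
  have hiK : i ∉ K := fun h => hi (Finset.mem_insert_of_mem h)
  have hil : i ≠ l := fun h => hi (h ▸ Finset.mem_insert_self _ _)
  have hcard : (insert i (insert l K)).card = K.card + 2 := by
    rw [Finset.card_insert_of_notMem hi, Finset.card_insert_of_notMem hl]
  have hlK := ih (insert l K).card (by rw [hcard, Finset.card_insert_of_notMem hl]; omega)
    (.insert hl hl' hll' hK') rfl
  rw [Finset.sum_insert hl] at hlK
  rw [Finset.sum_insert hi, Finset.sum_insert hl]
  have hsi := C.simpleRoot_mem_realRoots a i
  have hsl := C.simpleRoot_mem_realRoots a l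
  -- Here `l` was added to `K` before `i`. If `i` is attached to `K`, the middle summand `v` is the
  -- sum over `K`; otherwise `i` is attached to `l`, and `v` is `simpleRoot l`.
  by_cases hjK : j ∈ K
  · have hiK' := ih (insert i K).card
      (by rw [hcard, Finset.card_insert_of_notMem hiK]; omega) (.insert hiK hjK hij hK') rfl
    rw [Finset.sum_insert hiK] at hiK'
    have hji : j ≠ i := fun h => hiK (h ▸ hjK)
    have hjl : j ≠ l := fun h => hl (h ▸ hjK)
    have := add_add_mem_realRoots hC (s₁ := i) (s₂ := j) (s₃ := l)
      (simpleRoot_self i) (simpleRoot_ne hji) (simpleRoot_ne hil.symm)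
      (sum_simpleRoot_apply_of_notMem hiK) (sum_simpleRoot_apply_of_mem hjK)
      (sum_simpleRoot_apply_of_notMem hl)
      (simpleRoot_ne hil) (simpleRoot_ne hjl) (simpleRoot_self l)
      hsi hsl hiK' (by rwa [add_comm])
    rwa [add_comm (simpleRoot l), ← add_assoc]
  · obtain rfl : j = l := (Finset.mem_insert.1 hj).resolve_right hjK
    obtain ⟨k, hk⟩ := hK'.nonempty
    have hki : k ≠ i := fun h => hiK (h ▸ hk)
    have hkj : k ≠ j := fun h => hl (h ▸ hk)
    rw [← add_assoc]
    exact add_add_mem_realRoots hC (s₁ := i) (s₂ := j) (s₃ := k)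
      (simpleRoot_self i) (simpleRoot_ne hil.symm) (simpleRoot_ne hki)
      (simpleRoot_ne hil) (simpleRoot_self j) (simpleRoot_ne hkj)
      (sum_simpleRoot_apply_of_notMem hiK) (sum_simpleRoot_apply_of_notMem hl)
      (sum_simpleRoot_apply_of_mem hk) hsi
      (ih K.card (by omega) hK' rfl)
      (simpleRoot_add_simpleRoot_mem_realRoots hC hil (hr _ _ hij)) hlK

theorem Separates.refl_of_mem {C : CartanScheme I A} (hC : C.IsRootSystem C.realRoots) {a : A}
    {S : Set I} (h : C.Separates a S) {i : I} (hi : i ∈ S) : C.Separates (C.refl i a) S := by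
  intro k hk j hj
  suffices h0 : C.cartan (C.refl i a) k j = 0 from ⟨h0, (C.isGCM _).zero_symm _ _ h0⟩
  by_contra h0
  have hkj : k ≠ j := fun e => hj (e ▸ hk)
  have hij : i ≠ j := fun e => hj (e ▸ hi)
  have hki : k ≠ i := by
    rintro rfl
    rw [← C.cartan_refl] at h0
    exact h0 (h k hk j hj).1
  have h1 : C.cartan (C.refl i a) k j < 0 := lt_of_le_of_ne ((C.isGCM _).nonpos k j hkj) h0
  have h2 : simpleRoot j - C.cartan (C.refl i a) k j • simpleRoot k ∈
      C.realRoots (C.refl i a) := by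
    rw [C.cartan_refl _ k, ← sigma_simpleRoot, hC.sigma_refl_mem_iff]
    exact C.simpleRoot_mem_realRoots _ j
  rw [← hC.sigma_refl_mem_iff] at h2
  have hij0 : C.cartan (C.refl i a) i j = 0 := by
    rw [← C.cartan_refl]
    exact (h i hi j hj).1
  -- At `a`, the entries between `j` and `i`, `k` vanish, so this reflection only flips the sign of
  -- the coefficient at `j`, while the one at `k` stays positive.
  have h3 := hC.sigma_mem j h2
  simp only [map_sub, map_smul, sigma_simpleRoot, hij0, (h k hk j hj).2, (h i hi j hj).2,
    (C.isGCM a).diag, zero_smul, sub_zero] at h3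
  refine hC.not_pos_and_neg h3 (i := k) (j := j) ?_ ?_
  · simpa [simpleRoot_self, simpleRoot_ne hkj, simpleRoot_ne hki] using h1
  · simp [simpleRoot_self, simpleRoot_ne hkj.symm, simpleRoot_ne hij.symm]

theorem Separates.refl {C : CartanScheme I A} (hC : C.IsRootSystem C.realRoots) {a : A}
    {S : Set I} (h : C.Separates a S) (i : I) : C.Separates (C.refl i a) S := by
  by_cases hi : i ∈ S
  · exact h.refl_of_mem hC hi
  · simpa using (h.compl.refl_of_mem hC hi).compl

theorem Separates.sigma_apply_eq_zero {C : CartanScheme I A} {a : A} {S : Set I}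
    (h : C.Separates a S) (i : I) {x : I → ℤ} (hx : ∀ j ∉ S, x j = 0) {j : I} (hj : j ∉ S) :
    C.sigma a i x j = 0 := by
  rcases eq_or_ne j i with rfl | hji
  · have h0 : C.cartanForm a j x = 0 := by
      rw [cartanForm_apply]
      refine Finset.sum_eq_zero fun k _ => ?_
      by_cases hk : k ∈ S
      · rw [(h k hk j hj).2, zero_mul]
      · rw [hx k hk, mul_zero]
    rw [sigma_apply, h0, zero_smul, sub_zero, hx j hj]
  · rw [sigma_apply_of_ne C a hji, hx j hj]

theorem Separates.wordMap_apply_eq_zero {C : CartanScheme I A}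
    (hC : C.IsRootSystem C.realRoots) {S : Set I} {x : I → ℤ} (hx : ∀ j ∉ S, x j = 0)
    (l : List I) {a : A} (h : C.Separates a S) {j : I} (hj : j ∉ S) :
    C.wordMap a l x j = 0 := by
  induction l generalizing a j with
  | nil => exact hx j hj
  | cons i l ih => exact (h.refl hC i).sigma_apply_eq_zero i (fun k hk => ih (h.refl hC i) hk) hj

theorem Separates.eq_zero_of_mem_realRoots {C : CartanScheme I A}
    (hC : C.IsRootSystem C.realRoots) {S : Set I} {a : A} (h : C.Separates a S) {x : I → ℤ}
    (hx : x ∈ C.realRoots a) {i j : I} (hi : i ∈ S) (hj : j ∉ S) : x i = 0 ∨ x j = 0 := by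
  obtain ⟨l, k, rfl⟩ := hx
  by_cases hk : k ∈ S
  · exact Or.inr (h.wordMap_apply_eq_zero hC
      (fun m hm => simpleRoot_ne fun e => hm (e ▸ hk)) l hj)
  · exact Or.inl (h.compl.wordMap_apply_eq_zero hC
      (fun m hm => simpleRoot_ne fun e => hm (e ▸ hk)) l (not_not.2 hi))

end CartanScheme

theorem mainTheorem9 {I A : Type*} [Fintype I] [DecidableEq I] [Nonempty I] [Nonempty A]
    (C : CartanScheme I A) (hC : C.IsFiniteRootSystem C.realRoots) (a : A) :
    (∑ i : I, simpleRoot i) ∈ C.realRoots a ↔ (C.dynkinDiagram a).Connected := by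
  constructor
  · intro h
    refine ⟨fun i j => ?_⟩
    by_contra hij
    -- The connected component of `i` splits the Cartan matrix.
    have hS : C.Separates a
        {k | (C.dynkinDiagram a).graph.toSimpleGraphInclusive.Reachable i k} := by
      intro k hk m hm
      have h0 : C.cartan a k m = 0 := by
        by_contra h0
        exact hm (hk.trans (SimpleGraph.Adj.reachable
          ((C.dynkinDiagram_adj a k m).2 ⟨fun e => hm (e ▸ hk), h0⟩)))
      exact ⟨h0, (C.isGCM a).zero_symm _ _ h0⟩
    have h1 := hS.eq_zero_of_mem_realRoots hC.isRootSystem h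
      (SimpleGraph.Reachable.refl i) hij
    rw [sum_simpleRoot_apply_of_mem (Finset.mem_univ i),
      sum_simpleRoot_apply_of_mem (Finset.mem_univ j)] at h1
    simp at h1
  · intro h
    exact CartanScheme.sum_simpleRoot_mem_realRoots hC
      (fun i j hij => hij.ne) (fun i j hij => ((C.dynkinDiagram_adj a i j).1 hij).2)
      (SimpleGraph.Connected.connectedBy_univ h)
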